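/- Let $G$ be a finite group and let $M$ be a $G$-lattice, that is, a $\mathbb{Z}G$-module whose underlying abelian group is free of finite rank. For an abelian group $A$ put $DA=\operatorname{Hom}_{\mathbb{Z}}(A,\mathbb{Q}/\mathbb{Z})$. Let $DM=\operatorname{Hom}_{\mathbb{Z}}(M,\mathbb{Q}/\mathbb{Z})$ and $M^*=\operatorname{Hom}_{\mathbb{Z}}(M,\mathbb{Z})$, regarded as $G$-modules with the action $(gf)(u)=f(g^{-1}u)$. Let $\hat H^n(G,-)$, $n\in\mathbb{Z}$, denote the Tate cohomology groups of $G$. Then for every integer $n$ there are isomorphisms of abelian groups $$\hat H^{n-1}(G,DM)\simeq D\hat H^{-n}(G,M),$$ $$\hat H^{n}(G,DM)\simeq \hat H^{n+1}(G,M^*),$$ $$\hat H^{n}(G,M^*)\simeq D\hat H^{-n}(G,M).$$ -/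

import Mathlib

noncomputable section

/-- The group `ℚ/ℤ`: the quotient of the additive group `ℚ` by the subgroup generated by `1`. -/
abbrev QModZ : Type := AddCircle (1 : ℚ)

/-- The dual `D A = Hom(A, ℚ/ℤ)` of an abelian group `A`. -/
abbrev DualGroup (A : Type) [AddCommGroup A] : Type := A →+ QModZ

/-- The `G`-module `DM = Hom_ℤ(M, ℚ/ℤ)`. The group `G` acts trivially on `ℚ/ℤ`, so that
`(g f)(u) = f (g⁻¹ u)`. -/
abbrev dualModule {G M : Type} [Group G] [AddCommGroup M] (ρ : Representation ℤ G M) :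
    Representation ℤ G (M →ₗ[ℤ] QModZ) :=
  Representation.linHom ρ (Representation.trivial ℤ G QModZ)

/-- The `G`-module `M* = Hom_ℤ(M, ℤ)` with the action `(g f)(u) = f (g⁻¹ u)`. -/
abbrev dualLattice {G M : Type} [Group G] [AddCommGroup M] (ρ : Representation ℤ G M) :
    Representation ℤ G (M →ₗ[ℤ] ℤ) :=
  Representation.dual ρ

/-- The Tate cohomology group `Ĥⁿ(G, M)`, for `n : ℤ`, of the `G`-module `M` with action `ρ`. -/
abbrev TateH {G M : Type} [Group G] [Fintype G] [AddCommGroup M] (n : ℤ)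
    (ρ : Representation ℤ G M) : Type :=
  tateCohomology (Rep.of ρ) n

end

/-! For an injective abelian group `I`, `Hom(-, I)` is exact and so commutes with homology. Since
`G` is finite, dualizing the Tate complex of `M` exchanges chains with cochains and gives the Tate
complex of `Hom(M, I)` with degrees reflected by `n ↦ -1 - n` (`tateComplexDualEquiv_d`). Taking `I
= ℚ/ℤ` yields the first isomorphism. Taking `I = ℚ`, together with the fact that `|G|` kills Tate
cohomology in nonnegative degrees, shows that `Hom(M, ℚ)` has no Tate cohomology. As `M` is free, `0
→ M* → Hom(M, ℚ) → DM → 0` is exact, and its connecting maps are the second isomorphism. The third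
is the composite of the other two. -/

open CategoryTheory

noncomputable section

/-! ### Homology of the dual of a complex. -/

section LinearAlgebra

variable {R : Type} [CommRing R] {I : Type} [AddCommGroup I] [Module R I]

/-- A map into an injective module that vanishes on the kernel of `g` factors through `g`. -/
lemma Module.Baer.exists_comp_eq (hI : Module.Baer R I) {B C : Type} [AddCommGroup B]
    [AddCommGroup C] [Module R B] [Module R C] (g : B →ₗ[R] C) (φ : B →ₗ[R] I)
    (h : LinearMap.ker g ≤ LinearMap.ker φ) : ∃ θ : C →ₗ[R] I, θ ∘ₗ g = φ := by
  obtain ⟨θ, hθ⟩ := hI.extension_property ((LinearMap.ker g).liftQ g le_rfl)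
    (LinearMap.ker_eq_bot.mp (Submodule.ker_liftQ_eq_bot _ _ _ le_rfl))
    ((LinearMap.ker g).liftQ φ h)
  refine ⟨θ, LinearMap.ext fun b => ?_⟩
  simpa using LinearMap.congr_fun hθ ((LinearMap.ker g).mkQ b)

/-- If the short complex `S'` is the dual of the short complex `S` with respect to an injective
module `I`, then the homology of `S'` is the dual of the homology of `S`. -/
theorem CategoryTheory.ShortComplex.nonempty_homology_linearEquiv_dual (hI : Module.Baer R I)
    (S S' : ShortComplex (ModuleCat.{0} R))
    (e₁ : S'.X₁ ≃ₗ[R] (S.X₃ →ₗ[R] I)) (e₂ : S'.X₂ ≃ₗ[R] (S.X₂ →ₗ[R] I))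
    (e₃ : S'.X₃ ≃ₗ[R] (S.X₁ →ₗ[R] I))
    (hf : ∀ x, e₂ (S'.f.hom x) = e₁ x ∘ₗ S.g.hom) (hg : ∀ x, e₃ (S'.g.hom x) = e₂ x ∘ₗ S.f.hom) :
    Nonempty (S'.homology ≃ₗ[R] (S.homology →ₗ[R] I)) := by
  have hker (x : S'.X₂) : S'.g.hom x = 0 ↔ e₂ x ∘ₗ S.f.hom = 0 := by
    rw [← hg, e₃.map_eq_zero_iff]
  let H := LinearMap.ker S.g.hom ⧸ LinearMap.range S.moduleCatToCycles
  let Φ : LinearMap.ker S'.g.hom →ₗ[R] (H →ₗ[R] I) :=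
    { toFun := fun y => (LinearMap.range S.moduleCatToCycles).liftQ
        (e₂ y ∘ₗ (LinearMap.ker S.g.hom).subtype) (by
          rintro _ ⟨a, rfl⟩
          exact LinearMap.congr_fun ((hker y).1 y.2) a)
      map_add' := fun x y => by ext; simp
      map_smul' := fun r y => by ext; simp }
  have hΦ (y) (b : LinearMap.ker S.g.hom) : Φ y (Submodule.Quotient.mk b) = e₂ y b := rfl
  have hsurj : Function.Surjective Φ := by
    intro φ
    obtain ⟨ψ, hψ⟩ := hI.extension_property (LinearMap.ker S.g.hom).subtype
      (Submodule.injective_subtype _) (φ ∘ₗ (LinearMap.range S.moduleCatToCycles).mkQ)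
    have hψ' (b : LinearMap.ker S.g.hom) : ψ b = φ (Submodule.Quotient.mk b) :=
      LinearMap.congr_fun hψ b
    refine ⟨⟨e₂.symm ψ, ?_⟩, ?_⟩
    · rw [LinearMap.mem_ker, hker, e₂.apply_symm_apply]
      ext a
      have := hψ' (S.moduleCatToCycles a)
      rw [(Submodule.Quotient.mk_eq_zero (LinearMap.range S.moduleCatToCycles)).2
        (LinearMap.mem_range_self _ a), map_zero] at this
      exact this
    · refine LinearMap.ext fun q => ?_
      obtain ⟨b, rfl⟩ := Submodule.Quotient.mk_surjective _ q
      rw [hΦ, e₂.apply_symm_apply, hψ']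
  have hkerΦ : LinearMap.range S'.moduleCatToCycles = LinearMap.ker Φ := by
    ext y
    constructor
    · rintro ⟨a, rfl⟩
      refine LinearMap.ext fun q => ?_
      obtain ⟨b, rfl⟩ := Submodule.Quotient.mk_surjective _ q
      have h1 := LinearMap.congr_fun (hf a) b.1
      rw [LinearMap.comp_apply, LinearMap.mem_ker.1 b.2, map_zero] at h1
      exact h1
    · intro hy
      -- A functional that is zero on all cycles factors through `S.g`, hence is a coboundary of the
      -- dual complex.
      obtain ⟨θ, hθ⟩ := hI.exists_comp_eq S.g.hom (e₂ y) fun b hb => by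
        have := LinearMap.congr_fun (LinearMap.mem_ker.1 hy) (Submodule.Quotient.mk ⟨b, hb⟩)
        exact this
      refine ⟨e₁.symm θ, Subtype.ext (e₂.injective ?_)⟩
      refine (hf _).trans ?_
      rw [e₁.apply_symm_apply, hθ]
  exact ⟨S'.moduleCatHomologyIso.toLinearEquiv ≪≫ₗ
    Submodule.quotEquivOfEq _ _ hkerΦ ≪≫ₗ Φ.quotKerEquivOfSurjective hsurj ≪≫ₗ
    LinearEquiv.congrLeft I R S.moduleCatHomologyIso.toLinearEquiv.symm⟩

end LinearAlgebra

/-- The `G`-module `Hom_ℤ(M, I)`, with `G` acting trivially on `I`. -/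
abbrev homRep {G M : Type} [Group G] [AddCommGroup M] (ρ : Representation ℤ G M)
    (I : Type) [AddCommGroup I] : Rep ℤ G :=
  Rep.of (Representation.linHom ρ (Representation.trivial ℤ G I))

/-- The involution `n ↦ -1 - n` of `ℤ`. -/
def tateDualIndex : ℤ → ℤ
  | .ofNat n => .negSucc n
  | .negSucc n => .ofNat n

/-- The definition by cases lets the terms of the Tate complex reduce definitionally; this formula
serves the index arithmetic. -/
lemma tateDualIndex_eq (n : ℤ) : tateDualIndex n = -1 - n := by
  cases n <;> simp [tateDualIndex] <;> lia

/-! ### Self-duality of the Tate complex. -/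

section Duality

section ChainLevel

variable {G M : Type} [AddCommGroup M] (I : Type) [AddCommGroup I]

/-- Cochains with values in `Hom(M, I)` are the dual of chains with values in `M`. -/
def cochainsDualEquiv (n : ℕ) :
    ((Fin n → G) → (M →ₗ[ℤ] I)) ≃ₗ[ℤ] (((Fin n → G) →₀ M) →ₗ[ℤ] I) :=
  Finsupp.lsum ℤ

/-- Chains with values in `Hom(M, I)` are the dual of cochains with values in `M`. -/
def chainsDualEquiv [Fintype G] (n : ℕ) :
    ((Fin n → G) →₀ (M →ₗ[ℤ] I)) ≃ₗ[ℤ] (((Fin n → G) → M) →ₗ[ℤ] I) :=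
  open scoped Classical in
  Finsupp.linearEquivFunOnFinite ℤ _ _ ≪≫ₗ LinearMap.lsum ℤ (fun _ : Fin n → G => M) ℤ

lemma cochainsDualEquiv_single (n : ℕ) (f : (Fin n → G) → (M →ₗ[ℤ] I)) (g : Fin n → G) (m : M) :
    cochainsDualEquiv I n f (Finsupp.single g m) = f g m := by
  simp [cochainsDualEquiv]

lemma chainsDualEquiv_single [Fintype G] (n : ℕ) (φ : M →ₗ[ℤ] I) (g : Fin n → G) (f : (Fin n → G) → M) :
    chainsDualEquiv I n (Finsupp.single g φ) f = φ (f g) := by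
  classical
  have h : chainsDualEquiv I n (Finsupp.single g φ) f =
      ∑ x, (Pi.single g φ : (Fin n → G) → (M →ₗ[ℤ] I)) x (f x) := by simp [chainsDualEquiv]
  rw [h, Finset.sum_eq_single_of_mem g (Finset.mem_univ g)
    fun x _ hx => by rw [Pi.single_eq_of_ne hx, LinearMap.zero_apply], Pi.single_eq_same]

end ChainLevel

variable {G M : Type} [Group G] [AddCommGroup M] (ρ : Representation ℤ G M)
  (I : Type) [AddCommGroup I]

lemma cochainsDualEquiv_d (n : ℕ) (f : (Fin n → G) → (M →ₗ[ℤ] I)) :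
    cochainsDualEquiv I (n + 1) ((inhomogeneousCochains.d (homRep ρ I) n).hom f) =
      cochainsDualEquiv I n f ∘ₗ (groupHomology.inhomogeneousChains.d (Rep.of ρ) n).hom := by
  refine Finsupp.lhom_ext fun g m => ?_
  rw [cochainsDualEquiv_single, LinearMap.comp_apply,
    groupHomology.inhomogeneousChains.d_single (A := Rep.of ρ), inhomogeneousCochains.d_hom_apply]
  simp [cochainsDualEquiv_single, map_sum]

variable [Fintype G]

lemma chainsDualEquiv_d (n : ℕ) (x : (Fin (n + 1) → G) →₀ (M →ₗ[ℤ] I)) :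
    chainsDualEquiv I n ((groupHomology.inhomogeneousChains.d (homRep ρ I) n).hom x) =
      chainsDualEquiv I (n + 1) x ∘ₗ (inhomogeneousCochains.d (Rep.of ρ) n).hom := by
  induction x using Finsupp.induction_linear with
  | zero => simp
  | add x y hx hy => simp only [map_add, hx, hy, LinearMap.add_comp]
  | single g φ =>
    rw [groupHomology.inhomogeneousChains.d_single (A := homRep ρ I)]
    ext f
    rw [LinearMap.comp_apply, chainsDualEquiv_single, inhomogeneousCochains.d_hom_apply]
    simp [chainsDualEquiv_single, map_sum]

/-- The norm is its own transpose: transposing turns `g` into `g⁻¹`, which only permutes the sum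
over `G`. -/
lemma tateNormDual (x : (Fin 0 → G) →₀ (M →ₗ[ℤ] I)) :
    cochainsDualEquiv I 0 ((homRep ρ I).tateNorm.hom x) =
      chainsDualEquiv I 0 x ∘ₗ (Rep.of ρ).tateNorm.hom := by
  rw [Rep.tateNorm_eq, Rep.tateNorm_eq]
  induction x using Finsupp.induction_linear with
  | zero => simp
  | add x y hx hy => simp only [map_add, hx, hy, LinearMap.add_comp]
  | single g φ =>
    refine Finsupp.lhom_ext fun g' m => ?_
    rw [cochainsDualEquiv_single, LinearMap.comp_apply]
    simp [chainsDualEquiv_single, Representation.norm]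
    exact Equiv.sum_comp (Equiv.inv G) fun x => φ (ρ x m)

/-- The Tate complex of `Hom(M, I)` in degree `n` is the dual of the Tate complex of `M` in
degree `-1 - n`. -/
def tateComplexDualEquiv : ∀ n : ℤ, (tateComplex (homRep ρ I)).X n ≃ₗ[ℤ]
      ((tateComplex (Rep.of ρ)).X (tateDualIndex n) →ₗ[ℤ] I)
  | .ofNat n => cochainsDualEquiv I n
  | .negSucc n => chainsDualEquiv I n

lemma tateComplexDualEquiv_d (n m : ℤ) (h : n + 1 = m) (x : (tateComplex (homRep ρ I)).X n) :
    tateComplexDualEquiv ρ I m (((tateComplex (homRep ρ I)).d n m).hom x) =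
      tateComplexDualEquiv ρ I n x ∘ₗ
        ((tateComplex (Rep.of ρ)).d (tateDualIndex m) (tateDualIndex n)).hom := by
  -- The three cases are the cochain differentials, the norm from degree -1 to 0, and the chain
  -- differentials.
  obtain n | _ | n := n
  · obtain rfl : m = .ofNat (n + 1) := by simp [← h]
    have h1 := groupCohomology.inhomogeneousCochains.d_def (homRep ρ I) n
    have h2 := groupHomology.inhomogeneousChains.d_def (Rep.of ρ) n
    have := cochainsDualEquiv_d ρ I n x
    rw [← h1, ← h2] at this
    exact this
  · obtain rfl : m = .ofNat 0 := by simp [← h]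
    exact tateNormDual ρ I x
  · obtain rfl : m = .negSucc n := by lia
    have h1 := groupCohomology.inhomogeneousCochains.d_def (Rep.of ρ) n
    have h2 := groupHomology.inhomogeneousChains.d_def (homRep ρ I) n
    have := chainsDualEquiv_d ρ I n x
    rw [← h1, ← h2] at this
    exact this

/-- Tate duality for modules of homomorphisms into a divisible group. -/
theorem nonempty_tateCohomology_homRep_linearEquiv (hI : Module.Baer ℤ I) (n m : ℤ)
    (h : m = -1 - n) :
    Nonempty (tateCohomology (homRep ρ I) n ≃ₗ[ℤ] (tateCohomology (Rep.of ρ) m →ₗ[ℤ] I)) := by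
  let T := tateComplex (Rep.of ρ)
  let T' := tateComplex (homRep ρ I)
  obtain rfl : m = tateDualIndex n := by rw [h, tateDualIndex_eq]
  obtain ⟨e⟩ := ShortComplex.nonempty_homology_linearEquiv_dual hI
    (T.sc' (tateDualIndex (n + 1)) (tateDualIndex n) (tateDualIndex (n - 1)))
    (T'.sc' (n - 1) n (n + 1))
    (tateComplexDualEquiv ρ I (n - 1)) (tateComplexDualEquiv ρ I n)
    (tateComplexDualEquiv ρ I (n + 1))
    (tateComplexDualEquiv_d ρ I _ _ (by lia)) (tateComplexDualEquiv_d ρ I _ _ (by lia))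
  have e₁ := (T'.homologyIsoSc' (n - 1) n (n + 1) (by simp) (by simp)).toLinearEquiv
  have e₂ := (T.homologyIsoSc' (tateDualIndex (n + 1)) (tateDualIndex n) (tateDualIndex (n - 1))
    (by simp [tateDualIndex_eq]; lia) (by simp [tateDualIndex_eq]; lia)).toLinearEquiv
  exact ⟨e₁ ≪≫ₗ e ≪≫ₗ LinearEquiv.congrLeft I ℤ e₂.symm⟩

end Duality

/-! ### Annihilation by the group order. -/

section Torsion

variable {k G : Type} [CommRing k] [Group G] [Fintype G]

/-- The appended entry changes only when the contraction meets it; averaging over `s` will absorb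
that change. -/
lemma Fin.contractNth_castSucc_snoc {α : Type} (op : α → α → α) {n : ℕ} (j : Fin (n + 1))
    (g : Fin (n + 1) → α) (s : α) :
    Fin.contractNth j.castSucc op (Fin.snoc g s : Fin (n + 2) → α) =
      (Fin.snoc (Fin.contractNth j op g) (if j = Fin.last n then op (g (Fin.last n)) s else s) :
        Fin (n + 1) → α) := by
  ext k
  induction k using Fin.lastCases with
  | last =>
    rw [Fin.snoc_last]
    split_ifs with h
    · subst h
      rw [Fin.contractNth_apply_of_eq _ _ _ _ (by simp), Fin.succ_last, Fin.snoc_last,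
        Fin.snoc_castSucc]
    · have : (j : ℕ) < n := by have := Fin.val_lt_last h; simpa using this
      rw [Fin.contractNth_apply_of_gt _ _ _ _ (by simpa using this), Fin.succ_last, Fin.snoc_last]
  | cast k =>
    rw [Fin.snoc_castSucc]
    simp only [Fin.contractNth, Fin.val_castSucc, ← Fin.castSucc_succ, Fin.snoc_castSucc]

lemma Fin.contractNth_last {α : Type} (op : α → α → α) {n : ℕ} (g : Fin (n + 1) → α) :
    Fin.contractNth (Fin.last n) op g = fun i => g i.castSucc := by
  ext k
  exact Fin.contractNth_apply_of_lt _ _ _ _ (by simp)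

/-- In positive degrees the order of `G` times an inhomogeneous cocycle is a coboundary. -/
lemma Representation.exists_coboundary_eq_card_smul {V : Type} [AddCommGroup V]
    [Module k V] (ρ : Representation k G V) (n : ℕ) (f : (Fin (n + 1) → G) → V)
    (hf : ∀ g : Fin (n + 2) → G, ρ (g 0) (f fun i => g i.succ) +
      ∑ j : Fin (n + 2), (-1 : k) ^ ((j : ℕ) + 1) • f (Fin.contractNth j (· * ·) g) = 0) :
    ∃ h : (Fin n → G) → V, ∀ g : Fin (n + 1) → G, ρ (g 0) (h fun i => g i.succ) +
      ∑ j : Fin (n + 1), (-1 : k) ^ ((j : ℕ) + 1) • h (Fin.contractNth j (· * ·) g) =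
        Fintype.card G • f g := by
  -- Sum `f` over its last variable. Summing the cocycle identity over that variable leaves `(-1) ^
  -- n • |G| • f g` as its last term, which fixes the sign.
  refine ⟨fun a => (-1 : k) ^ (n + 1) • ∑ s, f (Fin.snoc a s), fun g => ?_⟩
  have key : ∑ s : G, (0 : V) = (ρ (g 0) (∑ s, f (Fin.snoc (fun i => g i.succ) s)) +
      ∑ j : Fin (n + 1), (-1 : k) ^ ((j : ℕ) + 1) •
        ∑ s, f (Fin.snoc (Fin.contractNth j (· * ·) g) s)) +
      (-1 : k) ^ n • Fintype.card G • f g := by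
    rw [← Finset.sum_congr rfl fun s _ => hf (Fin.snoc g s), Finset.sum_add_distrib, map_sum,
      add_assoc]
    congr 1
    · refine Finset.sum_congr rfl fun s _ => ?_
      congr 2
      ext i
      induction i using Fin.lastCases with
      | last => simp
      | cast i => simp only [← Fin.castSucc_succ, Fin.snoc_castSucc]
    · rw [Finset.sum_comm, Fin.sum_univ_castSucc]
      congr 1
      · refine Finset.sum_congr rfl fun j _ => ?_
        rw [Finset.smul_sum]
        simp only [Fin.contractNth_castSucc_snoc, Fin.val_castSucc]
        split_ifs
        -- Here the last entry is `g (Fin.last n) * s`, and the product runs over `G` with `s`.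
        · exact Equiv.sum_comp (Equiv.mulLeft (g (Fin.last n))) fun s =>
            (-1 : k) ^ ((j : ℕ) + 1) • f (Fin.snoc (Fin.contractNth j (· * ·) g) s)
        · rfl
      · simp [Fin.contractNth_last, pow_succ, smul_comm ((-1 : k) ^ n)]
  rw [Finset.sum_const_zero] at key
  have hsq : (-1 : k) ^ (n + 1) * (-1 : k) ^ n = -1 := by
    rw [← pow_add, show n + 1 + n = 2 * n + 1 by ring]
    simp [pow_succ]
  rw [map_smul]
  simp only [smul_comm _ ((-1 : k) ^ (n + 1))]
  rw [← Finset.smul_sum, ← smul_add, eq_neg_of_add_eq_zero_left key.symm, smul_neg, smul_smul, hsq,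
    neg_smul, one_smul, neg_neg]

lemma inhomogeneousCochains.exists_d_eq_card_smul (A : Rep.{0} k G) (n : ℕ)
    (f : (Fin (n + 1) → G) → A) (hf : (inhomogeneousCochains.d A (n + 1)).hom f = 0) :
    ∃ h, (inhomogeneousCochains.d A n).hom h = Fintype.card G • f := by
  obtain ⟨h, hh⟩ := Representation.exists_coboundary_eq_card_smul A.ρ n f fun g => by
    rw [← inhomogeneousCochains.d_hom_apply, hf]
    rfl
  refine ⟨h, funext fun g => ?_⟩
  rw [inhomogeneousCochains.d_hom_apply]
  exact hh g

/-- The order of `G` times a `0`-cocycle is a norm. -/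
lemma Rep.exists_tateNorm_eq_card_smul (A : Rep.{0} k G) (f : (Fin 0 → G) → A)
    (hf : (inhomogeneousCochains.d A 0).hom f = 0) :
    ∃ h, A.tateNorm.hom h = Fintype.card G • f := by
  -- A 0-cocycle is an invariant vector, and the norm multiplies it by `|G|`.
  refine ⟨Finsupp.single default (f default), ?_⟩
  rw [Rep.tateNorm_eq]
  have hinv (g : G) : A.ρ g (f default) = f default := by
    have := congrFun hf fun _ => g
    rw [inhomogeneousCochains.d_hom_apply] at this
    replace this : _ = (0 : A) := this
    simpa [← sub_eq_add_neg, sub_eq_zero, Subsingleton.elim _ (default : Fin 0 → G)] using this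
  ext x
  simp [Representation.norm, hinv, Unique.eq_default x]

lemma tateComplex_exists_d_eq_card_smul (A : Rep.{0} k G) (n : ℕ) (i : ℤ) (hi : i + 1 = n)
    (x : (tateComplex A).X n) (hx : ((tateComplex A).d n (n + 1)).hom x = 0) :
    ∃ y, ((tateComplex A).d i n).hom y = Fintype.card G • x := by
  have h1 := groupCohomology.inhomogeneousCochains.d_def A n
  have hx' : (inhomogeneousCochains.d A n).hom x = 0 := by rw [← h1]; exact hx
  obtain _ | n := n
  · obtain rfl : i = -1 := by simpa using eq_neg_of_add_eq_zero_left hi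
    exact Rep.exists_tateNorm_eq_card_smul A x hx'
  · obtain rfl : i = n := by simpa using hi
    obtain ⟨h, hh⟩ := inhomogeneousCochains.exists_d_eq_card_smul A n x hx'
    rw [← groupCohomology.inhomogeneousCochains.d_def A n] at hh
    exact ⟨h, hh⟩

/-- Tate cohomology in nonnegative degrees is killed by the order of the group. -/
theorem tateCohomology_card_smul (A : Rep.{0} k G) (n : ℕ) (x : tateCohomology A n) :
    Fintype.card G • x = 0 := by
  let S := (tateComplex A).sc' (n - 1) n (n + 1)
  let e := ((tateComplex A).homologyIsoSc' (n - 1) n (n + 1) (by simp) (by simp)).toLinearEquiv ≪≫ₗ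
    S.moduleCatHomologyIso.toLinearEquiv
  apply e.injective
  refine (map_nsmul e _ _).trans (Eq.trans ?_ (map_zero e).symm)
  obtain ⟨y, hy⟩ := Submodule.Quotient.mk_surjective (LinearMap.range S.moduleCatToCycles) (e x)
  obtain ⟨z, hz⟩ := tateComplex_exists_d_eq_card_smul A n (n - 1) (by simp) y.1 y.2
  rw [← hy]
  exact (Submodule.Quotient.mk_eq_zero (LinearMap.range S.moduleCatToCycles)
    (x := Fintype.card G • y)).2 ⟨z, Subtype.ext hz⟩

/-- One of the degrees `n` and `-1 - n` is nonnegative, so `|G|` kills one argument of the pairing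
`e x y`; its rational value is then zero. -/
theorem subsingleton_tateCohomology_homRep_rat {M : Type} [AddCommGroup M]
    (ρ : Representation ℤ G M) (n : ℤ) : Subsingleton (tateCohomology (homRep ρ ℚ) n) := by
  obtain ⟨e⟩ := nonempty_tateCohomology_homRep_linearEquiv ρ ℚ (Module.Baer.of_divisible ℚ) n _ rfl
  have hc : (Fintype.card G : ℚ) ≠ 0 := by exact_mod_cast Fintype.card_ne_zero
  refine subsingleton_of_forall_eq 0 fun x => e.injective ?_
  rw [map_zero]
  ext y
  have h : Fintype.card G • e x y = 0 := by
    obtain n | n := n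
    · rw [← LinearMap.smul_apply, ← map_nsmul, tateCohomology_card_smul _ n x, map_zero,
        LinearMap.zero_apply]
    · obtain ⟨k, hk⟩ : ∃ k : ℕ, -1 - Int.negSucc n = k := ⟨n, by lia⟩
      generalize -1 - Int.negSucc n = m at *
      subst hk
      rw [← map_nsmul, tateCohomology_card_smul _ k y, map_zero]
  rw [nsmul_eq_mul] at h
  simpa [hc] using h

end Torsion

lemma Rep.shortExact_of_exact {k G : Type} [CommRing k] [Group G]
    (S : ShortComplex (Rep.{0} k G)) (hf : Function.Injective S.f.hom)
    (hfg : ∀ x, S.g.hom x = 0 → ∃ y, S.f.hom y = x) (hg : Function.Surjective S.g.hom) :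
    S.ShortExact where
  exact := (ShortComplex.exact_map_iff_of_faithful S (forget₂ (Rep k G) (ModuleCat k))).1
    ((ShortComplex.moduleCat_exact_iff _).2 hfg)
  mono_f := (Rep.mono_iff_injective _).2 hf
  epi_g := (Rep.epi_iff_surjective _).2 hg

/-! ### Dimension shifting from `ℚ/ℤ` to `ℤ`. -/

section ExactSequence

variable {G M : Type} [Group G] [AddCommGroup M] (ρ : Representation ℤ G M)

/-- The map `Hom(M, I) ⟶ Hom(M, J)` induced by `I → J`. -/
def homRepMap {I J : Type} [AddCommGroup I] [AddCommGroup J] (φ : I →+ J) :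
    homRep ρ I ⟶ homRep ρ J :=
  Rep.ofHom ⟨φ.toIntLinearMap.compRight ℤ, fun g => by ext; simp⟩

/-- The quotient map `ℚ → ℚ/ℤ`. -/
def ratToQModZ : ℚ →+ QModZ := QuotientAddGroup.mk' _

lemma ratToQModZ_eq_zero_iff (q : ℚ) : ratToQModZ q = 0 ↔ ∃ z : ℤ, (z : ℚ) = q := by
  refine (QuotientAddGroup.eq_zero_iff q).trans ?_
  simp [AddSubgroup.mem_zmultiples_iff]

/-- The sequence `Hom(M, ℤ) ⟶ Hom(M, ℚ) ⟶ Hom(M, ℚ/ℤ)`. -/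
def homRepSequence : ShortComplex (Rep.{0} ℤ G) :=
  ShortComplex.mk (homRepMap ρ (Int.castAddHom ℚ)) (homRepMap ρ ratToQModZ)
    (Rep.hom_ext (Representation.IntertwiningMap.ext (LinearMap.ext fun (f : M →ₗ[ℤ] ℤ) =>
      LinearMap.ext fun m => (ratToQModZ_eq_zero_iff _).2 ⟨f m, rfl⟩)))

lemma homRepSequence_shortExact [Module.Free ℤ M] : (homRepSequence ρ).ShortExact := by
  refine Rep.shortExact_of_exact _ (fun (a b : M →ₗ[ℤ] ℤ) h => ?_)
    (fun (f : M →ₗ[ℤ] ℚ) hf => ?_) (fun (f : M →ₗ[ℤ] QModZ) => ?_)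
  · exact LinearMap.ext fun m => Int.cast_injective (α := ℚ) (LinearMap.congr_fun h m)
  · have h (m : M) : ∃ z : ℤ, (z : ℚ) = f m :=
      (ratToQModZ_eq_zero_iff _).1 (LinearMap.congr_fun hf m)
    choose z hz using h
    refine ⟨(AddMonoidHom.mk' z fun a b => ?_).toIntLinearMap, LinearMap.ext hz⟩
    exact_mod_cast (by rw [hz, hz, hz, map_add] : (z (a + b) : ℚ) = z a + z b)
  -- Freeness of `M` enters here, to lift maps along `ℚ → ℚ/ℤ`.
  · exact Module.projective_lifting_property ratToQModZ.toIntLinearMap f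
      (QuotientAddGroup.mk'_surjective _)

variable [Fintype G]

lemma isZero_tateCohomology_homRep_rat (n : ℤ) :
    Limits.IsZero (tateCohomology (homRep ρ ℚ) n) :=
  have := subsingleton_tateCohomology_homRep_rat ρ n
  ModuleCat.isZero_of_subsingleton _

/-- Dimension shifting along `0 → Hom(M, ℤ) → Hom(M, ℚ) → Hom(M, ℚ/ℤ) → 0`. -/
def tateCohomologyHomRepIso [Module.Free ℤ M] (n : ℤ) :
    tateCohomology (homRep ρ QModZ) n ≅ tateCohomology (homRep ρ ℤ) (n + 1) :=
  (TateCohomology.map_tateComplexFunctor_shortExact (homRepSequence_shortExact ρ)).δIso n (n + 1)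
    rfl
    (isZero_tateCohomology_homRep_rat ρ n) (isZero_tateCohomology_homRep_rat ρ (n + 1))

end ExactSequence

end

theorem proposition3p2 {G : Type} [Group G] [Fintype G]
    {M : Type} [AddCommGroup M] [Module.Free ℤ M] [Module.Finite ℤ M]
    (ρ : Representation ℤ G M) (n : ℤ) :
    Nonempty (TateH (n - 1) (dualModule ρ) ≃+ DualGroup (TateH (-n) ρ)) ∧
    Nonempty (TateH n (dualModule ρ) ≃+ TateH (n + 1) (dualLattice ρ)) ∧
    Nonempty (TateH n (dualLattice ρ) ≃+ DualGroup (TateH (-n) ρ)) := by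
  have duality : Nonempty (TateH (n - 1) (dualModule ρ) ≃+ DualGroup (TateH (-n) ρ)) := by
    obtain ⟨e⟩ := nonempty_tateCohomology_homRep_linearEquiv ρ QModZ
      (Module.Baer.of_divisible QModZ) (n - 1) (-n) (by lia)
    exact ⟨e.toAddEquiv.trans
      { toFun := fun f => f.toAddMonoidHom
        invFun := fun f => { f with map_smul' := fun k x => by simpa using map_intCast_smul f ℤ ℤ k x }
        left_inv := fun _ => rfl
        right_inv := fun _ => rfl
        map_add' := fun _ _ => rfl }⟩
  have shift (k : ℤ) : TateH k (dualModule ρ) ≃+ TateH (k + 1) (dualLattice ρ) :=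
    (tateCohomologyHomRepIso ρ k).toLinearEquiv.toAddEquiv
  refine ⟨duality, ⟨shift n⟩, ?_⟩
  obtain ⟨e⟩ := duality
  have s := shift (n - 1)
  rw [sub_add_cancel] at s
  exact ⟨s.symm.trans e⟩
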